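/- Let $n\ge 1$, let $0=x_0<x_1<x_2<\dots$ be real numbers with $x_k\to+\infty$, and let $\mathcal H_k$ ($k\ge1$) be real symmetric $n\times n$ matrices. Put $d_k=x_k-x_{k-1}$ and $r_{k+1}=\sqrt{d_k+d_{k+1}}$ for $k\ge 1$. For $k\ge1$ let $$A_k=\frac1{r_{k+1}^{2}}\Big[\mathcal H_k+\Big(\frac1{d_k}+\frac1{d_{k+1}}\Big)I\Big],\qquad B_k=-\frac{1}{r_{k+1}r_{k+2}d_{k+1}}\,I,$$ and let $A_0,B_0$ be arbitrary real symmetric $n\times n$ matrices with $B_0$ invertible. Let $J$ be the block Jacobi matrix with diagonal blocks $A_0,A_1,\dots$, blocks $B_0,B_1,\dots$ above the diagonal and $B_0^*,B_1^*,\dots$ below it. Let $\mathcal L_0$ be the minimal closed symmetric operator generated by $J$ in the Hilbert space $l^2_n$ of square summable sequences $(u_j)_{j\ge0}$ of vectors of $\mathbb C^n$, i.e. the closure of the operator $u\mapsto Ju$, $$(Ju)_0=A_0u_0+B_0u_1,\qquad (Ju)_j=B_{j-1}^*u_{j-1}+A_ju_j+B_ju_{j+1}\quad(j\ge1),$$ defined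 on the finitely supported sequences. If $$\sum_{k=1}^{\infty}d_k^2=+\infty,$$ then the determinate case holds for $J$: the deficiency indices of $\mathcal L_0$, i.e. the dimensions of $\operatorname{Ran}(\mathcal L_0+iI)^{\perp}$ and $\operatorname{Ran}(\mathcal L_0-iI)^{\perp}$, are both equal to $0$. -/

import Mathlib

namespace BlockJacobi

/-- The space `ℂⁿ` with its standard inner product. -/
abbrev Cn (n : ℕ) : Type := EuclideanSpace ℂ (Fin n)

/-- The Hilbert space of square summable sequences `u₀, u₁, …` of vectors of `ℂⁿ`. -/
abbrev EllTwo (n : ℕ) : Type := lp (fun _ : ℕ => Cn n) 2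

/-- The formal action of the block Jacobi matrix with diagonal blocks `A j`, blocks `B j` above the
diagonal and blocks `(B j)ᴴ` below it, on an arbitrary sequence of vectors:
`(J u)₀ = A₀ u₀ + B₀ u₁` and `(J u)ⱼ = Bⱼ₋₁ᴴ uⱼ₋₁ + Aⱼ uⱼ + Bⱼ uⱼ₊₁` for `j ≥ 1`. -/
noncomputable def formalAction {n : ℕ} (A B : ℕ → Matrix (Fin n) (Fin n) ℂ) :
    (ℕ → Cn n) →ₗ[ℂ] (ℕ → Cn n) where
  toFun u j := match j with
    | 0 => (A 0).toEuclideanLin (u 0) + (B 0).toEuclideanLin (u 1)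
    | j + 1 => (B j).conjTranspose.toEuclideanLin (u j) + (A (j + 1)).toEuclideanLin (u (j + 1))
        + (B (j + 1)).toEuclideanLin (u (j + 2))
  map_add' u v := by
    funext j
    cases j <;> simp only [Pi.add_apply, map_add] <;> abel
  map_smul' c u := by
    funext j
    cases j <;> simp only [Pi.smul_apply, map_smul, smul_add, RingHom.id_apply]

/-- The finitely supported sequences, as a subspace of `ℓ²`. -/
def finiteSequences (n : ℕ) : Submodule ℂ (EllTwo n) where
  carrier := {u | (Function.support (u : ℕ → Cn n)).Finite}
  zero_mem' := by
    change (Function.support ((0 : EllTwo n) : ℕ → Cn n)).Finite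
    rw [lp.coeFn_zero, Function.support_zero]
    exact Set.finite_empty
  add_mem' {u v} hu hv := by
    exact (Set.Finite.union hu hv).subset (Function.support_add (u : ℕ → Cn n) (v : ℕ → Cn n))
  smul_mem' c u hu := by
    refine Set.Finite.subset hu ?_
    intro j hj
    simp only [Function.mem_support, lp.coeFn_smul, Pi.smul_apply] at hj ⊢
    exact fun h => hj (by rw [h, smul_zero])

theorem formalAction_support_finite {n : ℕ} (A B : ℕ → Matrix (Fin n) (Fin n) ℂ)
    {u : ℕ → Cn n} (hu : (Function.support u).Finite) :
    (Function.support (formalAction A B u)).Finite := by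
  obtain ⟨N, hN⟩ := hu.bddAbove
  have hz : ∀ j, N < j → u j = 0 := fun j hj => by
    by_contra h
    exact absurd (hN h) (not_le.mpr hj)
  refine (Set.finite_Iic (N + 1)).subset fun j hj => ?_
  by_contra h
  simp only [Set.mem_Iic, not_le] at h
  apply hj
  cases j with
  | zero => omega
  | succ j =>
    simp [formalAction, hz j (by omega), hz (j + 1) (by omega), hz (j + 2) (by omega)]

theorem memℓp_formalAction {n : ℕ} (A B : ℕ → Matrix (Fin n) (Fin n) ℂ)
    (u : finiteSequences n) :
    Memℓp (formalAction A B (u : EllTwo n)) 2 :=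
  (memℓp_zero (formalAction_support_finite A B u.2)).of_exponent_ge (by simp)

/-- The operator given by the block Jacobi matrix on the finitely supported sequences. -/
noncomputable def preminimalOperator {n : ℕ} (A B : ℕ → Matrix (Fin n) (Fin n) ℂ) :
    EllTwo n →ₗ.[ℂ] EllTwo n where
  domain := finiteSequences n
  toFun :=
    { toFun := fun u => ⟨formalAction A B (u : EllTwo n), memℓp_formalAction A B u⟩
      map_add' := fun u v => by
        apply Subtype.ext
        exact map_add (formalAction A B) (u : EllTwo n).1 (v : EllTwo n).1
      map_smul' := fun c u => by
        apply Subtype.ext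
        exact map_smul (formalAction A B) c (u : EllTwo n).1 }

/-- The minimal closed operator `ℒ₀` in `ℓ²` generated by the block Jacobi matrix: the closure of
its action on the finitely supported sequences. -/
noncomputable def minimalOperator {n : ℕ} (A B : ℕ → Matrix (Fin n) (Fin n) ℂ) :
    EllTwo n →ₗ.[ℂ] EllTwo n :=
  (preminimalOperator A B).closure

theorem continuous_coord {n : ℕ} (j : ℕ) : Continuous (fun u : EllTwo n => u j) :=
  (continuous_apply j).comp (lp.uniformContinuous_coe (p := 2)).continuous

/-- The closure used in `minimalOperator` is a genuine one. -/
theorem preminimalOperator_isClosable {n : ℕ} (A B : ℕ → Matrix (Fin n) (Fin n) ℂ) :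
    (preminimalOperator A B).IsClosable := by
  have key : ((preminimalOperator A B).graph.topologicalClosure : Set (EllTwo n × EllTwo n)) ⊆
      {p | ∀ j, p.2 j = formalAction A B p.1 j} := by
    refine closure_minimal ?_ ?_
    · rintro ⟨u, v⟩ h j
      obtain ⟨w, rfl, rfl⟩ := (LinearPMap.mem_graph_iff _).1 h
      rfl
    · have hc : ∀ (M : Matrix (Fin n) (Fin n) ℂ) (i : ℕ),
          Continuous fun p : EllTwo n × EllTwo n => M.toEuclideanLin (p.1 i) := fun M i =>
        (LinearMap.continuous_of_finiteDimensional M.toEuclideanLin).comp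
          ((continuous_coord i).comp continuous_fst)
      simp only [Set.ofPred_forall]
      refine isClosed_iInter fun j => isClosed_eq ((continuous_coord j).comp continuous_snd) ?_
      cases j with
      | zero => exact (hc _ _).add (hc _ _)
      | succ j => exact ((hc _ _).add (hc _ _)).add (hc _ _)
  refine ⟨(preminimalOperator A B).graph.topologicalClosure.toLinearPMap,
    (Submodule.toLinearPMap_graph_eq _ ?_).symm⟩
  rintro ⟨u, v⟩ h (rfl : u = 0)
  apply lp.ext
  funext j
  have h1 := key h j
  have h2 : formalAction A B ((0 : EllTwo n) : ℕ → Cn n) = 0 := map_zero (formalAction A B)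
  change v j = formalAction A B ((0 : EllTwo n) : ℕ → Cn n) j at h1
  rw [h1, h2]
  rfl

/-- The deficiency subspace of `T` at `z`: the orthogonal complement of the range of `T - z̄`,
that is, the kernel of `T* - z` when `T` is densely defined. -/
noncomputable def deficiencySubspace {E : Type*} [NormedAddCommGroup E] [InnerProductSpace ℂ E]
    (T : E →ₗ.[ℂ] E) (z : ℂ) : Submodule ℂ E :=
  (LinearMap.range (T.toFun - (starRingEnd ℂ z) • T.domain.subtype))ᗮ

/-- The pair `(d₊, d₋)` of the dimensions of the deficiency subspaces at `i` and `-i`. -/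
noncomputable def deficiencyIndices {E : Type*} [NormedAddCommGroup E] [InnerProductSpace ℂ E]
    (T : E →ₗ.[ℂ] E) : Cardinal × Cardinal :=
  (Module.rank ℂ (deficiencySubspace T Complex.I),
    Module.rank ℂ (deficiencySubspace T (-Complex.I)))

/-- The determinate case: the minimal operator has deficiency indices `(0, 0)`. -/
def IsDeterminate {n : ℕ} (A B : ℕ → Matrix (Fin n) (Fin n) ℂ) : Prop :=
  deficiencyIndices (minimalOperator A B) = (0, 0)

/-- `d_k = x_k - x_{k-1}`, used for `k ≥ 1`. -/
def d (x : ℕ → ℝ) (k : ℕ) : ℝ := x k - x (k - 1)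

/-- `r_k = √(d_{k-1} + d_k)`, used for `k ≥ 2`. -/
noncomputable def r (x : ℕ → ℝ) (k : ℕ) : ℝ := √(d x (k - 1) + d x k)

/-- The diagonal blocks: an arbitrary `A₀`, and
`A_k = r_{k+1}⁻² [H_k + (1/d_k + 1/d_{k+1}) I]` for `k ≥ 1`. -/
noncomputable def diagBlock {n : ℕ} (A₀ : Matrix (Fin n) (Fin n) ℝ) (x : ℕ → ℝ)
    (H : ℕ → Matrix (Fin n) (Fin n) ℝ) (k : ℕ) : Matrix (Fin n) (Fin n) ℝ :=
  if k = 0 then A₀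
  else (1 / r x (k + 1) ^ 2) • (H k + (1 / d x k + 1 / d x (k + 1)) • (1 : Matrix _ _ ℝ))

/-- The off-diagonal blocks: an arbitrary `B₀`, and
`B_k = -(r_{k+1} r_{k+2} d_{k+1})⁻¹ I` for `k ≥ 1`. -/
noncomputable def offDiagBlock {n : ℕ} (B₀ : Matrix (Fin n) (Fin n) ℝ) (x : ℕ → ℝ)
    (k : ℕ) : Matrix (Fin n) (Fin n) ℝ :=
  if k = 0 then B₀
  else -(1 / (r x (k + 1) * r x (k + 2) * d x (k + 1))) • (1 : Matrix _ _ ℝ)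

end BlockJacobi

/-!
The theorem is an instance of Carleman's test for block Jacobi matrices.

An element `u` of the deficiency subspace at `z` is a square summable solution of the difference
equation `J u = z u` (`formalAction_eq_smul_of_mem_deficiencySubspace`). Pairing this equation with
`u` and summing over `j ≤ N`, everything telescopes up to a boundary term, because the diagonal
blocks are Hermitian (`im_sum_inner_formalAction`):
`Im z * ∑_{j ≤ N} ‖u j‖² = Im ⟪u N, B N u (N + 1)⟫`.
If `u ≠ 0` and `Im z ≠ 0`, the left side stays away from zero for large `N`. So if
`c N * ‖B N v‖ ≤ ‖v‖` for all `v`, then `c N` is at most a constant times `‖u N‖ * ‖u (N + 1)‖`,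
hence summable. Divergence of `∑ c N` therefore forces `u = 0`
(`eq_zero_of_formalAction_eq_smul`), so both deficiency subspaces vanish.

For the blocks at hand `B_k = -(r_{k+1} r_{k+2} d_{k+1})⁻¹ I`, and both `r_{k+1}` and `r_{k+2}` are
at least `√d_{k+1}`, so that `c_k = d_{k+1}²` is admissible.
-/

namespace BlockJacobi

open scoped InnerProductSpace

/-! ### Deficiency subspaces and the difference equation -/

theorem deficiencySubspace_anti {E : Type*} [NormedAddCommGroup E] [InnerProductSpace ℂ E]
    {S T : E →ₗ.[ℂ] E} (h : S ≤ T) (z : ℂ) :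
    deficiencySubspace T z ≤ deficiencySubspace S z := by
  refine Submodule.orthogonal_le ?_
  rintro _ ⟨w, rfl⟩
  refine ⟨⟨w, h.1 w.2⟩, ?_⟩
  have hw : S w = T ⟨w, h.1 w.2⟩ := h.2 rfl
  change T ⟨w, h.1 w.2⟩ - (starRingEnd ℂ z) • (w : E) = S w - (starRingEnd ℂ z) • (w : E)
  rw [hw]

theorem inner_conjTranspose_toEuclideanLin_left {n : ℕ} (M : Matrix (Fin n) (Fin n) ℂ)
    (v w : Cn n) :
    ⟪M.conjTranspose.toEuclideanLin v, w⟫_ℂ = ⟪v, M.toEuclideanLin w⟫_ℂ := by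
  rw [Matrix.toEuclideanLin_conjTranspose_eq_adjoint, LinearMap.adjoint_inner_left]

theorem inner_toEuclideanLin_left {n : ℕ} (M : Matrix (Fin n) (Fin n) ℂ) (v w : Cn n) :
    ⟪M.toEuclideanLin v, w⟫_ℂ = ⟪v, M.conjTranspose.toEuclideanLin w⟫_ℂ := by
  rw [Matrix.toEuclideanLin_conjTranspose_eq_adjoint, LinearMap.adjoint_inner_right]

theorem single_mem_finiteSequences {n : ℕ} (j : ℕ) (a : Cn n) :
    (lp.single 2 j a : EllTwo n) ∈ finiteSequences n := by
  refine (Set.finite_singleton j).subset fun i hi => ?_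
  by_contra h
  exact hi (lp.single_apply_ne (E := fun _ => Cn n) 2 j a h)

/-- The Jacobi matrix is formally symmetric: pairing its `j`-th column with `u` gives the `j`-th
entry of `J u`. -/
theorem inner_preminimalOperator_single {n : ℕ} {A B : ℕ → Matrix (Fin n) (Fin n) ℂ}
    (hA : ∀ j, (A j).IsHermitian) (j : ℕ) (a : Cn n) (u : EllTwo n) :
    ⟪preminimalOperator A B ⟨lp.single 2 j a, single_mem_finiteSequences j a⟩, u⟫_ℂ
      = ⟪a, formalAction A B u j⟫_ℂ := by
  cases j with
  | zero =>
    have h : preminimalOperator A B ⟨lp.single 2 0 a, single_mem_finiteSequences 0 a⟩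
        = lp.single 2 0 ((A 0).toEuclideanLin a)
          + lp.single 2 1 ((B 0).conjTranspose.toEuclideanLin a) := by
      apply lp.ext
      funext i
      change formalAction A B (lp.single 2 0 a : EllTwo n) i = _
      rw [lp.coeFn_add, Pi.add_apply]
      rcases i with _ | _ | i <;> simp [formalAction, lp.single_apply]
    rw [h, inner_add_left, lp.inner_single_left, lp.inner_single_left,
      inner_conjTranspose_toEuclideanLin_left, inner_toEuclideanLin_left, (hA 0).eq,
      ← inner_add_right]
    rfl
  | succ j =>
    have h : preminimalOperator A B ⟨lp.single 2 (j + 1) a, single_mem_finiteSequences (j + 1) a⟩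
        = lp.single 2 j ((B j).toEuclideanLin a)
          + lp.single 2 (j + 1) ((A (j + 1)).toEuclideanLin a)
          + lp.single 2 (j + 2) ((B (j + 1)).conjTranspose.toEuclideanLin a) := by
      apply lp.ext
      funext i
      change formalAction A B (lp.single 2 (j + 1) a : EllTwo n) i = _
      rw [lp.coeFn_add, Pi.add_apply, lp.coeFn_add, Pi.add_apply]
      obtain rfl | h0 := eq_or_ne i j
      · cases i with
        | zero => simp [formalAction, lp.single_apply]
        | succ i =>
          have h3 : i ≠ i + 1 + 1 := by omega
          simp [formalAction, lp.single_apply, h3]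
      obtain rfl | h1 := eq_or_ne i (j + 1)
      · simp [formalAction, lp.single_apply]
      obtain rfl | h2 := eq_or_ne i (j + 2)
      · simp [formalAction, lp.single_apply]
      rcases i with _ | i
      · simp [formalAction, lp.single_apply, h0.symm]
      · have h3 : i ≠ j + 1 := by omega
        have h4 : i ≠ j := by omega
        have h5 : i + 1 ≠ j := by omega
        simp [formalAction, lp.single_apply, h3, h4, h5]
    rw [h, inner_add_left, inner_add_left, lp.inner_single_left, lp.inner_single_left,
      lp.inner_single_left, inner_conjTranspose_toEuclideanLin_left, inner_toEuclideanLin_left,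
      inner_toEuclideanLin_left, (hA (j + 1)).eq, ← inner_add_right, ← inner_add_right]
    rfl

theorem formalAction_eq_smul_of_mem_deficiencySubspace {n : ℕ}
    {A B : ℕ → Matrix (Fin n) (Fin n) ℂ} (hA : ∀ j, (A j).IsHermitian) {z : ℂ} {u : EllTwo n}
    (hu : u ∈ deficiencySubspace (minimalOperator A B) z) (j : ℕ) :
    formalAction A B u j = z • u j := by
  have hu' := deficiencySubspace_anti (LinearPMap.le_closure (preminimalOperator A B)) z hu
  refine ext_inner_left ℂ fun a => ?_
  have h : ⟪preminimalOperator A B ⟨lp.single 2 j a, single_mem_finiteSequences j a⟩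
      - (starRingEnd ℂ z) • (lp.single 2 j a : EllTwo n), u⟫_ℂ = 0 :=
    hu' _ ⟨⟨lp.single 2 j a, single_mem_finiteSequences j a⟩, rfl⟩
  rw [inner_sub_left, inner_preminimalOperator_single hA, inner_smul_left, lp.inner_single_left,
    Complex.conj_conj, sub_eq_zero] at h
  rw [h, inner_smul_right]

/-! ### Carleman's test -/

theorem im_inner_toEuclideanLin_self {n : ℕ} {M : Matrix (Fin n) (Fin n) ℂ}
    (hM : M.IsHermitian) (v : Cn n) : (⟪v, M.toEuclideanLin v⟫_ℂ).im = 0 := by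
  have h : (starRingEnd ℂ) ⟪v, M.toEuclideanLin v⟫_ℂ = ⟪v, M.toEuclideanLin v⟫_ℂ := by
    rw [inner_conj_symm, inner_toEuclideanLin_left, hM.eq]
  exact Complex.conj_eq_iff_im.1 h

/-- The discrete Green identity: only the boundary term survives. -/
theorem im_sum_inner_formalAction {n : ℕ} {A B : ℕ → Matrix (Fin n) (Fin n) ℂ}
    (hA : ∀ j, (A j).IsHermitian) (u : ℕ → Cn n) (N : ℕ) :
    ∑ j ∈ Finset.range (N + 1), (⟪u j, formalAction A B u j⟫_ℂ).im
      = (⟪u N, (B N).toEuclideanLin (u (N + 1))⟫_ℂ).im := by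
  induction N with
  | zero =>
    rw [Finset.sum_range_one]
    change (⟪u 0, (A 0).toEuclideanLin (u 0) + (B 0).toEuclideanLin (u 1)⟫_ℂ).im = _
    rw [inner_add_right, Complex.add_im, im_inner_toEuclideanLin_self (hA 0), zero_add]
  | succ N ih =>
    rw [Finset.sum_range_succ, ih]
    change _ + (⟪u (N + 1), (B N).conjTranspose.toEuclideanLin (u N)
      + (A (N + 1)).toEuclideanLin (u (N + 1))
      + (B (N + 1)).toEuclideanLin (u (N + 2))⟫_ℂ).im = _
    have h : (⟪u (N + 1), (B N).conjTranspose.toEuclideanLin (u N)⟫_ℂ).im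
        = -(⟪u N, (B N).toEuclideanLin (u (N + 1))⟫_ℂ).im := by
      rw [← inner_conj_symm, inner_conjTranspose_toEuclideanLin_left, Complex.conj_im]
    rw [inner_add_right, inner_add_right, Complex.add_im, Complex.add_im,
      im_inner_toEuclideanLin_self (hA (N + 1)), h]
    ring

/-- A nonzero square summable solution of `J u = z u` with `Im z ≠ 0` has boundary terms bounded away
from zero, and so makes `c` summable. -/
theorem eq_zero_of_formalAction_eq_smul {n : ℕ} {A B : ℕ → Matrix (Fin n) (Fin n) ℂ}
    (hA : ∀ j, (A j).IsHermitian) {c : ℕ → ℝ} (hc : ∀ k, 0 ≤ c k)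
    (hB : ∀ k, 1 ≤ k → ∀ v : Cn n, c k * ‖(B k).toEuclideanLin v‖ ≤ ‖v‖)
    (hsum : Filter.Tendsto (fun N => ∑ k ∈ Finset.range N, c k) Filter.atTop Filter.atTop)
    {z : ℂ} (hz : z.im ≠ 0) {u : ℕ → Cn n} (hu : Summable fun j => ‖u j‖ ^ 2)
    (hJ : ∀ j, formalAction A B u j = z • u j) : u = 0 := by
  by_contra hu0
  obtain ⟨m, hm⟩ : ∃ m, u m ≠ 0 := Function.ne_iff.1 hu0
  have hm2 : 0 < ‖u m‖ ^ 2 := by positivity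
  have hz' : 0 < |z.im| := abs_pos.2 hz
  have green (N : ℕ) : z.im * ∑ j ∈ Finset.range (N + 1), ‖u j‖ ^ 2
      = (⟪u N, (B N).toEuclideanLin (u (N + 1))⟫_ℂ).im := by
    rw [← im_sum_inner_formalAction hA, Finset.mul_sum]
    refine Finset.sum_congr rfl fun j _ => ?_
    have hj : ⟪u j, u j⟫_ℂ = ((‖u j‖ ^ 2 : ℝ) : ℂ) := by
      rw [inner_self_eq_norm_sq_to_K]
      norm_cast
    rw [hJ, inner_smul_right, hj, Complex.im_mul_ofReal]
  have lower (N : ℕ) (hN : m ≤ N) :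
      |z.im| * ‖u m‖ ^ 2 ≤ ‖u N‖ * ‖(B N).toEuclideanLin (u (N + 1))‖ := by
    calc |z.im| * ‖u m‖ ^ 2 ≤ |z.im| * ∑ j ∈ Finset.range (N + 1), ‖u j‖ ^ 2 := by
          refine mul_le_mul_of_nonneg_left ?_ hz'.le
          exact Finset.single_le_sum (f := fun j => ‖u j‖ ^ 2) (fun j _ => sq_nonneg ‖u j‖)
            (Finset.mem_range.2 (Nat.lt_succ_of_le hN))
      _ = |(⟪u N, (B N).toEuclideanLin (u (N + 1))⟫_ℂ).im| := by
          rw [← green, abs_mul,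
            abs_of_nonneg (Finset.sum_nonneg' (s := Finset.range (N + 1)) fun j => sq_nonneg ‖u j‖)]
      _ ≤ ‖⟪u N, (B N).toEuclideanLin (u (N + 1))⟫_ℂ‖ := Complex.abs_im_le_norm _
      _ ≤ _ := norm_inner_le_norm _ _
  have hu' : Summable fun j => ‖u (j + 1)‖ ^ 2 :=
    (summable_nat_add_iff (f := fun j => ‖u j‖ ^ 2) 1).2 hu
  have hcs : Summable c := by
    refine (summable_nat_add_iff (m + 1)).1 ?_
    have hdom := (summable_nat_add_iff (m + 1)).2
      (((hu.add hu').div_const 2).div_const (|z.im| * ‖u m‖ ^ 2))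
    refine Summable.of_nonneg_of_le (fun k => hc _) (fun k => ?_) hdom
    generalize hN : k + (m + 1) = N
    rw [le_div_iff₀ (by positivity)]
    calc c N * (|z.im| * ‖u m‖ ^ 2)
        ≤ c N * (‖u N‖ * ‖(B N).toEuclideanLin (u (N + 1))‖) :=
          mul_le_mul_of_nonneg_left (lower N (by omega)) (hc N)
      _ = ‖u N‖ * (c N * ‖(B N).toEuclideanLin (u (N + 1))‖) := by ring
      _ ≤ ‖u N‖ * ‖u (N + 1)‖ :=
          mul_le_mul_of_nonneg_left (hB N (by omega) _) (norm_nonneg _)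
      _ ≤ (‖u N‖ ^ 2 + ‖u (N + 1)‖ ^ 2) / 2 := by
          linarith [two_mul_le_add_sq ‖u N‖ ‖u (N + 1)‖]
  exact not_tendsto_atTop_of_tendsto_nhds hcs.hasSum.tendsto_sum_nat hsum

theorem deficiencySubspace_eq_bot_of_tendsto_sum {n : ℕ} {A B : ℕ → Matrix (Fin n) (Fin n) ℂ}
    (hA : ∀ j, (A j).IsHermitian) {c : ℕ → ℝ} (hc : ∀ k, 0 ≤ c k)
    (hB : ∀ k, 1 ≤ k → ∀ v : Cn n, c k * ‖(B k).toEuclideanLin v‖ ≤ ‖v‖)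
    (hsum : Filter.Tendsto (fun N => ∑ k ∈ Finset.range N, c k) Filter.atTop Filter.atTop)
    {z : ℂ} (hz : z.im ≠ 0) : deficiencySubspace (minimalOperator A B) z = ⊥ := by
  refine (Submodule.eq_bot_iff _).2 fun u hu => lp.ext ?_
  have hu2 : Summable fun j => ‖u j‖ ^ 2 := by
    simpa using (lp.memℓp u).summable (by norm_num)
  exact eq_zero_of_formalAction_eq_smul hA hc hB hsum hz hu2
    (formalAction_eq_smul_of_mem_deficiencySubspace hA hu)

/-- **Carleman's test** for block Jacobi matrices: if the diagonal blocks are Hermitian and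
`∑ 1 / ‖B k‖` diverges, then the determinate case holds. The norms enter through lower bounds `c k`
of `1 / ‖B k‖`, and the block `B 0` is unrestricted. -/
theorem isDeterminate_of_tendsto_sum {n : ℕ} {A B : ℕ → Matrix (Fin n) (Fin n) ℂ}
    (hA : ∀ j, (A j).IsHermitian) {c : ℕ → ℝ} (hc : ∀ k, 0 ≤ c k)
    (hB : ∀ k, 1 ≤ k → ∀ v : Cn n, c k * ‖(B k).toEuclideanLin v‖ ≤ ‖v‖)
    (hsum : Filter.Tendsto (fun N => ∑ k ∈ Finset.range N, c k) Filter.atTop Filter.atTop) :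
    IsDeterminate A B := by
  rw [IsDeterminate, deficiencyIndices,
    deficiencySubspace_eq_bot_of_tendsto_sum hA hc hB hsum (z := Complex.I) (by simp),
    deficiencySubspace_eq_bot_of_tendsto_sum hA hc hB hsum (z := -Complex.I) (by simp)]
  simp

/-! ### The blocks built from the points `x k` -/

theorem isSymm_diagBlock {n : ℕ} {A₀ : Matrix (Fin n) (Fin n) ℝ} (hA₀ : A₀.IsSymm) (x : ℕ → ℝ)
    {H : ℕ → Matrix (Fin n) (Fin n) ℝ} (hH : ∀ k, 1 ≤ k → (H k).IsSymm) (k : ℕ) :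
    (diagBlock A₀ x H k).IsSymm := by
  unfold diagBlock
  split_ifs with hk
  · exact hA₀
  · exact ((hH k (by omega)).add (Matrix.isSymm_one.smul _)).smul _

theorem isHermitian_map_algebraMap {n : ℕ} {M : Matrix (Fin n) (Fin n) ℝ} (hM : M.IsSymm) :
    (M.map (algebraMap ℝ ℂ)).IsHermitian := by
  ext i j
  simp [hM.apply i j]

theorem d_pos {x : ℕ → ℝ} (hx : StrictMono x) {k : ℕ} (hk : 1 ≤ k) : 0 < d x k :=
  sub_pos.2 (hx (by omega))

/-- Both factors `r_{k+1}` and `r_{k+2}` are at least `√d_{k+1}`. -/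
theorem d_le_r_mul_r {x : ℕ → ℝ} (hx : StrictMono x) {k : ℕ} (hk : 1 ≤ k) :
    d x (k + 1) ≤ r x (k + 1) * r x (k + 2) := by
  have h0 : 0 < d x (k + 1 - 1) := d_pos hx (by omega)
  have h1 : 0 < d x (k + 1) := d_pos hx (by omega)
  have h2 : 0 < d x (k + 2) := d_pos hx (by omega)
  calc d x (k + 1) = √(d x (k + 1)) * √(d x (k + 1)) := (Real.mul_self_sqrt h1.le).symm
    _ ≤ r x (k + 1) * r x (k + 2) :=
      mul_le_mul (Real.sqrt_le_sqrt (by linarith))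
        (Real.sqrt_le_sqrt (by change _ ≤ d x (k + 1) + d x (k + 2); linarith))
        (Real.sqrt_nonneg _) (Real.sqrt_nonneg _)

theorem d_sq_mul_norm_offDiagBlock_le {n : ℕ} (B₀ : Matrix (Fin n) (Fin n) ℝ) {x : ℕ → ℝ}
    (hx : StrictMono x) {k : ℕ} (hk : 1 ≤ k) (v : Cn n) :
    d x (k + 1) ^ 2 * ‖((offDiagBlock B₀ x k).map (algebraMap ℝ ℂ)).toEuclideanLin v‖ ≤ ‖v‖ := by
  have hd : 0 < d x (k + 1) := d_pos hx (by omega)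
  set b : ℝ := r x (k + 1) * r x (k + 2) * d x (k + 1) with hb
  have hdb : d x (k + 1) ^ 2 ≤ b := by
    rw [pow_two, hb]
    exact mul_le_mul_of_nonneg_right (d_le_r_mul_r hx hk) hd.le
  have hb0 : 0 < b := lt_of_lt_of_le (by positivity) hdb
  have hM : (offDiagBlock B₀ x k).map (algebraMap ℝ ℂ)
      = ((-(1 / b) : ℝ) : ℂ) • (1 : Matrix (Fin n) (Fin n) ℂ) := by
    rw [offDiagBlock, if_neg (by omega), ← hb]
    ext i j
    by_cases h : i = j <;> simp [h]
  have hv : ((offDiagBlock B₀ x k).map (algebraMap ℝ ℂ)).toEuclideanLin v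
      = ((-(1 / b) : ℝ) : ℂ) • v := by
    rw [hM, map_smul, LinearMap.smul_apply, Matrix.toLpLin_one, LinearMap.id_apply]
  rw [hv, norm_smul, Complex.norm_real, Real.norm_eq_abs, abs_neg, abs_of_pos (by positivity),
    ← mul_assoc, mul_one_div]
  exact mul_le_of_le_one_left (norm_nonneg v) ((div_le_one hb0).2 hdb)

end BlockJacobi

theorem mainTheorem5 (n : ℕ) (x : ℕ → ℝ) (hx0 : x 0 = 0) (hx : StrictMono x)
    (hxlim : Filter.Tendsto x Filter.atTop Filter.atTop)
    (H : ℕ → Matrix (Fin n) (Fin n) ℝ) (hH : ∀ k, 1 ≤ k → (H k).IsSymm)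
    (A₀ B₀ : Matrix (Fin n) (Fin n) ℝ) (hA₀ : A₀.IsSymm) (hB₀ : B₀.IsSymm) (hB₀' : IsUnit B₀)
    (hd : Filter.Tendsto (fun N : ℕ => ∑ k ∈ Finset.Icc 1 N, BlockJacobi.d x k ^ 2)
      Filter.atTop Filter.atTop) :
    BlockJacobi.IsDeterminate
      (fun k => (BlockJacobi.diagBlock A₀ x H k).map (algebraMap ℝ ℂ))
      (fun k => (BlockJacobi.offDiagBlock B₀ x k).map (algebraMap ℝ ℂ)) := by
  refine BlockJacobi.isDeterminate_of_tendsto_sum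
    (c := fun k => BlockJacobi.d x (k + 1) ^ 2)
    (fun k => BlockJacobi.isHermitian_map_algebraMap (BlockJacobi.isSymm_diagBlock hA₀ x hH k))
    (fun k => by positivity)
    (fun k hk v => BlockJacobi.d_sq_mul_norm_offDiagBlock_le B₀ hx hk v) ?_
  refine hd.congr fun N => ?_
  rw [Finset.range_eq_Ico, Finset.sum_Ico_add' (fun k => BlockJacobi.d x k ^ 2) 0 N 1]
  rfl
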